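/- Let $\langle Z,W\rangle = W^*JZ$ be the Hermitian form of signature $(2,1)$ on $\mathbb{C}^3$ with $J=\begin{pmatrix}0&0&1\\0&1&0\\1&0&0\end{pmatrix}$, and let $\mathbb{H}^2_{\mathbb{C}}\subset\mathbb{CP}^2$ be the set of lines spanned by vectors $Z$ with $\langle Z,Z\rangle<0$ (complex hyperbolic 2-space). For $u_0>0$ let $B_{u_0}\subset\mathbb{H}^2_{\mathbb{C}}$ be the open horoball at height $u_0$ based at $\infty=[1:0:0]$, that is, the set of points $\left[\tfrac{-|z|^2-u+iv}{2}:z:1\right]$ with $z\in\mathbb{C}$, $v\in\mathbb{R}$, $u>u_0$. Let $\mathcal{O}_{11}$ be the ring of integers of $\mathbb{Q}(i\sqrt{11})$ and let $\Gamma(11)=\operatorname{PU}(2,1;\mathcal{O}_{11})$ be the image in $\operatorname{PGL}(3,\mathbb{C})$ of the group of matrices in $\operatorname{GL}(3,\mathcal{O}_{11})$ that preserve $\langle\cdot,\cdot\rangle$. Let $u^{cov}$ be the covering height of $\Gamma(11)$, that is, the supremum of the $u>0$ for which the $\Gamma(11)$-translates of $B_u$ cover $\mathbb{H}^2_{\mathbb{C}}$,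 and let the covering depth of $\Gamma(11)$ be the positive integer $n$ with $\frac{2}{\sqrt{n+1}}<u^{cov}\le\frac{2}{\sqrt n}$. Then for $u=0.3015114$, which is greater than $2/\sqrt{44}$, the $\Gamma(11)$-translates of $B_u$ cover $\mathbb{H}^2_{\mathbb{C}}$. The covering depth of $\Gamma(11)$ exists, is unique, and is at most $43$. -/

import Mathlib

open scoped LinearAlgebra.Projectivization MatrixGroups Pointwise IntermediateField

noncomputable section

namespace PicardModular

/-- The matrix `J` of the Siegel Hermitian form, of signature `(2,1)`. -/
def siegelJ : Matrix (Fin 3) (Fin 3) ℂ :=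
  !![0, 0, 1; 0, 1, 0; 1, 0, 0]

/-- The Hermitian form `⟨Z, W⟩ = W* J Z` on `ℂ³`. -/
def herm (Z W : Fin 3 → ℂ) : ℂ :=
  star W ⬝ᵥ (siegelJ.mulVec Z)

/-- The complex projective plane. -/
abbrev CP2 : Type := ℙ ℂ (Fin 3 → ℂ)

/-- The complex hyperbolic plane `ℍ²_ℂ = π(V⁻)`, where `V⁻` is the set of vectors `Z` with
`⟨Z, Z⟩ < 0` (the number `⟨Z, Z⟩` is real). -/
def complexHyperbolicPlane : Set CP2 :=
  {p | ∃ (Z : Fin 3 → ℂ) (hZ : Z ≠ 0), (herm Z Z).re < 0 ∧ p = Projectivization.mk ℂ Z hZ}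

/-- The standard lift `ψ(z, v, u)` of the point with horospherical coordinates `(z, v, u)`. -/
def psi (z : ℂ) (v u : ℝ) : Fin 3 → ℂ :=
  ![(-((‖z‖ : ℂ) ^ 2) - u + Complex.I * v) / 2, z, 1]

theorem psi_ne_zero (z : ℂ) (v u : ℝ) : psi z v u ≠ 0 := by
  intro h
  have h2 := congrFun h 2
  simp [psi] at h2

/-- The open horoball `B_{u₀}` at height `u₀` based at `∞ = π((1,0,0)ᵀ)`. -/
def horoball (u₀ : ℝ) : Set CP2 :=
  {p | ∃ (z : ℂ) (v u : ℝ), u₀ < u ∧ p = Projectivization.mk ℂ (psi z v u) (psi_ne_zero z v u)}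

/-- The unitary group `U(2,1)` of the form `⟨·,·⟩`. -/
def U21 : Subgroup (GL (Fin 3) ℂ) where
  carrier := {A | ∀ Z W : Fin 3 → ℂ, herm (A.val.mulVec Z) (A.val.mulVec W) = herm Z W}
  one_mem' := by
    intro Z W
    simp
  mul_mem' := by
    intro A B hA hB Z W
    have h := hA (B.val.mulVec Z) (B.val.mulVec W)
    rw [hB Z W] at h
    simpa [Matrix.mulVec_mulVec] using h
  inv_mem' := by
    intro A hA Z W
    have h := hA ((A⁻¹).val.mulVec Z) ((A⁻¹).val.mulVec W)
    have hv : A.val * (A⁻¹).val = 1 := A.mul_inv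
    rw [Matrix.mulVec_mulVec, Matrix.mulVec_mulVec, hv, Matrix.one_mulVec,
      Matrix.one_mulVec] at h
    exact h.symm

/-- The ring of integers `𝒪_d` of the imaginary quadratic field `ℚ(i√d)`, as a subring of `ℂ`:
the elements of `ℚ(i√d)` that are integral over `ℤ`. -/
def ringO (d : ℕ) : Subring ℂ :=
  (integralClosure ℤ ℂ).toSubring ⊓ (ℚ⟮Complex.I * (Real.sqrt d : ℂ)⟯).toSubfield.toSubring

/-- The group `U(2,1; 𝒪_d)` of unitary matrices in `GL(3, 𝒪_d)`. -/
def U21Int (d : ℕ) : Subgroup (GL (Fin 3) ℂ) :=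
  U21 ⊓ (Matrix.GeneralLinearGroup.map (n := Fin 3) (ringO d).subtype).range

/-- The Picard modular group `Γ(d) = PU(2,1; 𝒪_d)`, the image of `U(2,1; 𝒪_d)` in `PGL(3, ℂ)`.
It acts on the projective plane. -/
def picardGroup (d : ℕ) : Subgroup PGL(3, ℂ) :=
  (U21Int d).map Matrix.ProjGenLinGroup.mk

/-- The `PU(2,1; 𝒪_d)`-translates of the horoball `B_u` cover the complex hyperbolic plane. -/
def TranslatesCover (d : ℕ) (u : ℝ) : Prop :=
  complexHyperbolicPlane ⊆ ⋃ γ ∈ picardGroup d, γ • horoball u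

/-- `h` is the covering height of `PU(2,1; 𝒪_d)`: the supremum of the heights `u > 0` such that
the translates of `B_u` cover. (As the horoballs are open, a supremum and not a maximum.) -/
def IsCoveringHeight (d : ℕ) (h : ℝ) : Prop :=
  IsLUB {u : ℝ | 0 < u ∧ TranslatesCover d u} h

/-- `n` is the covering depth of `PU(2,1; 𝒪_d)`: `2/√(n+1) < h ≤ 2/√n` for the covering
height `h`. -/
def IsCoveringDepth (d n : ℕ) : Prop :=
  0 < n ∧ ∃ h : ℝ, IsCoveringHeight d h ∧
    2 / Real.sqrt ((n : ℝ) + 1) < h ∧ h ≤ 2 / Real.sqrt n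

end PicardModular

end

/-!
The height of a point `[Z]` of the complex hyperbolic plane with respect to a cusp
`p = g e₁`, `g ∈ U(2,1; 𝒪₁₁)`, is `-⟨Z, Z⟩ / |⟨Z, p⟩|²`, and `[Z]` lies in the translate `g B_u` if
and only if this height exceeds `u`. So the translates of `B_u` cover if every negative `Z` is at
height greater than `u` for some cusp.

This is proved by descent (`exists_cusp_height`). If `[Z]` is at height at most `0.3015114` for `p`,
move `p` to `e₁` and normalize `Z` to `ψ(z, v, u)`. Some other cusp `q` then satisfies
`|⟨ψ(z, v, u), q⟩|² ≤ 2999 / 3000` (`hasCloserCusp_of_apply_two`), so the height grows by a fixed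
factor at each step and exceeds the bound after finitely many steps.

To find `q`, write `z = x + i√11 t` and `v = √11 w`. Heisenberg translations, complex conjugation
and the reflection `diag(1, -1, 1)` reduce to the box `0 ≤ x ≤ 1/2`, `0 ≤ t ≤ 1/4`, `|w| ≤ 1`. The
condition `|⟨ψ(z, v, u), q⟩| < 1` for isotropic `q` reads
`(|q₃ z - q₂|² + |q₃|² u)² + L² < 4 |q₃|²` with `L` affine in `(x, t, w)`, so it defines a convex
set, the Cygan ball of `q` (`IntVec.cygan_eq`, `IntVec.convexOn_cygan`), and a ball contains a box as
soon as it contains the eight vertices. A bisection of the fundamental box, carried out on integers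
by the kernel, shows that fourteen Cygan balls at height `39 / 128` cover it (`covered_cuspPairs`,
`Box.exists_cygan_lt_of_covered`). The gap between `39 / 128` and `0.3015114` gives the fixed factor.
That the fourteen vectors are cusps follows from the existence of an isotropic integral `q'` with
`⟨q', q⟩ = 1`, since such a pair extends to a unitary matrix (`IsCusp.exists_mulVec_infVec`).

The covering height is bounded by `2`, since nonzero elements of `𝒪₁₁` have norm at least `1`
(`le_two_of_translatesCover`); so it exists and lies in `[0.3015114, 2]`, and the covering depth is
the integer part of `4 / h²`.
-/

namespace PicardModular

open ComplexConjugate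

/-! ### The ring `𝒪_d` -/

theorem conj_mem_ringO {d : ℕ} {x : ℂ} (hx : x ∈ ringO d) : conj x ∈ ringO d := by
  obtain ⟨hint, hfield⟩ := hx
  refine ⟨IsIntegral.map (starRingEnd ℂ).toIntAlgHom hint, ?_⟩
  have hmap : (starRingEnd ℂ).toRatAlgHom x ∈
      (ℚ⟮Complex.I * (Real.sqrt d : ℂ)⟯).map (starRingEnd ℂ).toRatAlgHom := ⟨x, hfield, rfl⟩
  rw [IntermediateField.adjoin_map, Set.image_singleton] at hmap
  refine (IntermediateField.adjoin_simple_le_iff.2 ?_ : _ ≤ ℚ⟮Complex.I * (Real.sqrt d : ℂ)⟯) hmap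
  have : (starRingEnd ℂ).toRatAlgHom (Complex.I * (Real.sqrt d : ℂ))
      = -(Complex.I * (Real.sqrt d : ℂ)) := by simp
  rw [this]
  exact neg_mem (IntermediateField.mem_adjoin_simple_self ℚ _)

theorem I_mul_sqrt_sq (d : ℕ) : (Complex.I * (Real.sqrt d : ℂ)) ^ 2 = -(d : ℂ) := by
  rw [mul_pow, Complex.I_sq, ← Complex.ofReal_pow, Real.sq_sqrt d.cast_nonneg]
  simp

/-- Since `i√d` is algebraic, `ℚ(i√d)` is generated by it as an algebra. -/
theorem exists_rat_of_mem_adjoin {d : ℕ} {x : ℂ} (hx : x ∈ ℚ⟮Complex.I * (Real.sqrt d : ℂ)⟯) :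
    ∃ a b : ℚ, x = a + b * (Complex.I * (Real.sqrt d : ℂ)) := by
  have hint : IsIntegral ℚ (Complex.I * (Real.sqrt d : ℂ)) := by
    refine IsIntegral.of_pow (n := 2) two_pos ?_
    rw [I_mul_sqrt_sq]
    simpa using isIntegral_algebraMap (R := ℚ) (A := ℂ) (x := (-d : ℚ))
  rw [← IntermediateField.mem_toSubalgebra,
    IntermediateField.adjoin_simple_toSubalgebra_of_isAlgebraic hint.isAlgebraic] at hx
  induction hx using Algebra.adjoin_induction with
  | mem y hy => exact ⟨0, 1, by simpa using hy⟩
  | algebraMap r => exact ⟨r, 0, by simp⟩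
  | add y z _ _ hy hz =>
    obtain ⟨a, b, rfl⟩ := hy
    obtain ⟨a', b', rfl⟩ := hz
    exact ⟨a + a', b + b', by push_cast; ring⟩
  | mul y z _ _ hy hz =>
    obtain ⟨a, b, rfl⟩ := hy
    obtain ⟨a', b', rfl⟩ := hz
    refine ⟨a * a' - d * b * b', a * b' + a' * b, ?_⟩
    push_cast
    linear_combination (b * b' : ℂ) * I_mul_sqrt_sq d

/-- An element of `ℚ(i√d)` has the form `a + b i√d`, so its norm is rational; for an algebraic
integer that norm is a non-negative integer. -/
theorem one_le_normSq_of_mem_ringO {d : ℕ} {x : ℂ} (hx : x ∈ ringO d) (h0 : x ≠ 0) :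
    1 ≤ Complex.normSq x := by
  obtain ⟨a, b, hab⟩ := exists_rat_of_mem_adjoin hx.2
  have hint : IsIntegral ℤ (x * conj x) :=
    IsIntegral.mul hx.1 (conj_mem_ringO hx).1
  have hrat : ∃ q : ℚ, x * conj x = q := by
    refine ⟨a ^ 2 + d * b ^ 2, ?_⟩
    have hconj : conj x = a - b * (Complex.I * (Real.sqrt d : ℂ)) := by
      rw [hab]
      simp [sub_eq_add_neg]
    rw [hconj, hab]
    push_cast
    linear_combination (-b ^ 2 : ℂ) * I_mul_sqrt_sq d
  obtain ⟨k, hk⟩ := hint.exists_int_iff_exists_rat.1 hrat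
  rw [Complex.mul_conj] at hk
  have hk' : Complex.normSq x = (k : ℝ) := by exact_mod_cast hk
  have hpos := Complex.normSq_pos.2 h0
  rw [hk'] at hpos ⊢
  exact_mod_cast hpos

/-- The generator `(1 + i√11) / 2` of the ring `𝒪₁₁`. -/
noncomputable def omega : ℂ := (1 + Complex.I * (Real.sqrt 11 : ℂ)) / 2

theorem omega_sq : omega ^ 2 = omega - 3 := by
  have h := I_mul_sqrt_sq 11
  push_cast at h
  unfold omega
  linear_combination h / 4

theorem conj_omega : conj omega = 1 - omega := by
  simp only [omega, map_div₀, map_add, map_one, map_mul, Complex.conj_I, Complex.conj_ofReal,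
    map_ofNat]
  ring

theorem omega_mem : omega ∈ ringO 11 := by
  constructor
  · refine ⟨Polynomial.X ^ 2 - Polynomial.X + 3, ?_, ?_⟩
    · monicity!
    · have h := omega_sq
      simp only [Polynomial.eval₂_add, Polynomial.eval₂_sub, Polynomial.eval₂_pow,
        Polynomial.eval₂_X, Polynomial.eval₂_ofNat]
      linear_combination h
  · change omega ∈ ℚ⟮Complex.I * (Real.sqrt (11 : ℕ) : ℂ)⟯
    have hg := IntermediateField.mem_adjoin_simple_self ℚ (Complex.I * (Real.sqrt (11 : ℕ) : ℂ))
    have h : omega = (1 + Complex.I * (Real.sqrt (11 : ℕ) : ℂ)) / 2 := by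
      simp [omega]
    rw [h]
    exact div_mem (add_mem (one_mem _) hg) (ofNat_mem _ 2)

/-- The element `a + bω` of `𝒪₁₁`. -/
noncomputable def ofInts (a b : ℤ) : ℂ := a + b * omega

theorem ofInts_mem (a b : ℤ) : ofInts a b ∈ ringO 11 :=
  add_mem (intCast_mem _ a) (mul_mem (intCast_mem _ b) omega_mem)

theorem conj_ofInts (a b : ℤ) : conj (ofInts a b) = ofInts (a + b) (-b) := by
  simp only [ofInts, map_add, map_mul, map_intCast, conj_omega]
  push_cast
  ring

/-! ### The Hermitian form and cusps -/

theorem herm_apply (Z W : Fin 3 → ℂ) :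
    herm Z W = conj (W 0) * Z 2 + conj (W 1) * Z 1 + conj (W 2) * Z 0 := by
  simp [herm, siegelJ, dotProduct, Matrix.mulVec, Fin.sum_univ_three]

theorem conj_herm (Z W : Fin 3 → ℂ) : conj (herm Z W) = herm W Z := by
  simp only [herm_apply, map_add, map_mul, Complex.conj_conj]
  ring

theorem herm_smul_left (c : ℂ) (Z W : Fin 3 → ℂ) : herm (c • Z) W = c * herm Z W := by
  simp only [herm_apply, Pi.smul_apply, smul_eq_mul]
  ring

theorem herm_smul_smul (c : ℂ) (Z : Fin 3 → ℂ) :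
    herm (c • Z) (c • Z) = Complex.normSq c * herm Z Z := by
  simp only [herm_apply, Pi.smul_apply, smul_eq_mul, map_mul, Complex.normSq_eq_conj_mul_self]
  ring

/-- The vector `e₁ = (1, 0, 0)`, which spans the point `∞`. -/
def infVec : Fin 3 → ℂ := ![1, 0, 0]

theorem herm_infVec (Z : Fin 3 → ℂ) : herm Z infVec = Z 2 := by
  simp [herm_apply, infVec]

/-- A matrix with entries in `𝒪_d` that satisfies `M* J M = J` is an element of `U(2,1; 𝒪_d)`:
its inverse `J M* J` has entries in `𝒪_d` as well. -/
theorem exists_mem_U21Int {d : ℕ} (M : Matrix (Fin 3) (Fin 3) ℂ) (hM : ∀ i j, M i j ∈ ringO d)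
    (hJ : M.conjTranspose * siegelJ * M = siegelJ) :
    ∃ g ∈ U21Int d, g.val = M := by
  have hJJ : siegelJ * siegelJ = 1 := by
    ext i j
    fin_cases i <;> fin_cases j <;> simp [siegelJ, Matrix.mul_apply, Fin.sum_univ_three]
  have hinv : siegelJ * M.conjTranspose * siegelJ * M = 1 := by
    rw [Matrix.mul_assoc, Matrix.mul_assoc, ← Matrix.mul_assoc _ siegelJ M, hJ, hJJ]
  have hinv' := mul_eq_one_comm.1 hinv
  have hJmem : ∀ i j, siegelJ i j ∈ ringO d := by
    intro i j
    fin_cases i <;> fin_cases j <;> simp [siegelJ]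
  have hmul : ∀ A B : Matrix (Fin 3) (Fin 3) ℂ, (∀ i j, A i j ∈ ringO d) →
      (∀ i j, B i j ∈ ringO d) → ∀ i j, (A * B) i j ∈ ringO d := fun A B hA hB i j ↦ by
    rw [Matrix.mul_apply]
    exact sum_mem fun k _ ↦ mul_mem (hA i k) (hB k j)
  have hN := hmul _ _ (hmul _ M.conjTranspose hJmem fun i j ↦ conj_mem_ringO (hM j i)) hJmem
  have hlift : ∀ A : Matrix (Fin 3) (Fin 3) ℂ, (∀ i j, A i j ∈ ringO d) →
      ∃ A' : Matrix (Fin 3) (Fin 3) (ringO d), A'.map (ringO d).subtype = A :=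
    fun A hA ↦ ⟨Matrix.of fun i j ↦ ⟨A i j, hA i j⟩, rfl⟩
  obtain ⟨M', hM'⟩ := hlift M hM
  obtain ⟨N', hN'⟩ := hlift _ hN
  have hone : ∀ A B : Matrix (Fin 3) (Fin 3) (ringO d),
      A.map (ringO d).subtype * B.map (ringO d).subtype = 1 → A * B = 1 := fun A B h ↦ by
    apply Matrix.map_injective (f := (ringO d).subtype) Subtype.val_injective
    simpa only [Matrix.map_mul, Matrix.map_one _ (map_zero (ringO d).subtype) (map_one _)] using h
  refine ⟨⟨M, siegelJ * M.conjTranspose * siegelJ, hinv', hinv⟩, ⟨fun Z W ↦ ?_, ?_⟩, rfl⟩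
  · rw [herm, herm, Matrix.star_mulVec, ← Matrix.dotProduct_mulVec, Matrix.mulVec_mulVec,
      Matrix.mulVec_mulVec, hJ]
  · exact ⟨⟨M', N', hone _ _ (by rw [hM', hN', hinv']), hone _ _ (by rw [hM', hN', hinv])⟩,
      Units.ext hM'⟩

theorem apply_mem_ringO {d : ℕ} {g : GL (Fin 3) ℂ} (hg : g ∈ U21Int d) (i j : Fin 3) :
    g.val i j ∈ ringO d := by
  obtain ⟨-, N, rfl⟩ := hg
  exact (N.val i j).2

/-- `p` is an isotropic vector of `𝒪₁₁³` that has an isotropic partner `q` in `𝒪₁₁³` with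
`⟨q, p⟩ = 1`. These are the vectors of the orbit of `e₁` under `U(2,1; 𝒪₁₁)`. -/
def IsCusp (p : Fin 3 → ℂ) : Prop :=
  ∃ q : Fin 3 → ℂ, (∀ i, p i ∈ ringO 11) ∧ (∀ i, q i ∈ ringO 11) ∧
    herm p p = 0 ∧ herm q q = 0 ∧ herm q p = 1

theorem IsCusp.smul {p : Fin 3 → ℂ} (hp : IsCusp p) {g : GL (Fin 3) ℂ} (hg : g ∈ U21Int 11) :
    IsCusp (g.val.mulVec p) := by
  have hmem : ∀ r : Fin 3 → ℂ, (∀ i, r i ∈ ringO 11) → ∀ i, g.val.mulVec r i ∈ ringO 11 :=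
    fun r hr i ↦ by
      rw [Matrix.mulVec, dotProduct]
      exact sum_mem fun k _ ↦ mul_mem (apply_mem_ringO hg i k) (hr k)
  obtain ⟨q, h1, h2, h3, h4, h5⟩ := hp
  have hU := hg.1
  exact ⟨g.val.mulVec q, hmem p h1, hmem q h2, (hU _ _).trans h3, (hU _ _).trans h4,
    (hU _ _).trans h5⟩

theorem isCusp_infVec : IsCusp infVec := by
  refine ⟨![0, 0, 1], ?_, ?_, ?_, ?_, ?_⟩
  · intro i; fin_cases i <;> simp [infVec]
  · intro i; fin_cases i <;> simp
  all_goals simp [herm_apply, infVec]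

/-- The isotropic vectors `p`, `q` and the vector `J conj(p × q)`, which is orthogonal to both and
has norm `1`, form the columns of a matrix in `U(2,1; 𝒪₁₁)`. -/
theorem IsCusp.exists_mulVec_infVec {p : Fin 3 → ℂ} (hp : IsCusp p) :
    ∃ g ∈ U21Int 11, g.val.mulVec infVec = p := by
  obtain ⟨q, hpO, hqO, hpp, hqq, hqp⟩ := hp
  have hpq : herm p q = 1 := by rw [← conj_herm, hqp, map_one]
  set r : Fin 3 → ℂ := ![conj (p 0 * q 1 - p 1 * q 0), conj (p 2 * q 0 - p 0 * q 2),
    conj (p 1 * q 2 - p 2 * q 1)] with hr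
  rw [herm_apply] at hpp hqq hqp hpq
  obtain ⟨g, hg, hgM⟩ := exists_mem_U21Int (d := 11)
    !![p 0, r 0, q 0; p 1, r 1, q 1; p 2, r 2, q 2] (by
      have hrO : ∀ i, r i ∈ ringO 11 := by
        intro i
        fin_cases i <;> exact conj_mem_ringO (sub_mem (mul_mem (hpO _) (hqO _))
          (mul_mem (hpO _) (hqO _)))
      intro i j
      fin_cases i <;> fin_cases j <;> [exact hpO 0; exact hrO 0; exact hqO 0; exact hpO 1; exact hrO 1; exact hqO 1;
        exact hpO 2; exact hrO 2; exact hqO 2]) (by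
    ext i j
    fin_cases i <;> fin_cases j <;>
      simp [siegelJ, Matrix.mul_apply, Fin.sum_univ_three, hr]
    · linear_combination hpp
    · ring
    · linear_combination hqp
    · ring
    · linear_combination (-(conj (q 0) * q 2 + conj (q 1) * q 1 + conj (q 2) * q 0)) * hpp +
        (conj (p 0) * q 2 + conj (p 1) * q 1 + conj (p 2) * q 0) * hpq + hqp
    · ring
    · linear_combination hpq
    · ring
    · linear_combination hqq)
  refine ⟨g, hg, ?_⟩
  rw [hgM]
  ext i
  fin_cases i <;> simp [infVec, Matrix.mulVec, dotProduct, Fin.sum_univ_three]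

/-! ### Cygan balls of integral isotropic vectors -/

theorem norm_add_I_mul_sqrt_sq (x t : ℝ) :
    (‖(x + Complex.I * Real.sqrt 11 * t : ℂ)‖ : ℂ) ^ 2 = x ^ 2 + 11 * t ^ 2 := by
  have hθ : (Complex.I * Real.sqrt 11) ^ 2 = (-11 : ℂ) := by simpa using I_mul_sqrt_sq 11
  rw [← Complex.mul_conj']
  simp only [map_add, map_mul, Complex.conj_I, Complex.conj_ofReal]
  linear_combination (-t ^ 2 : ℂ) * hθ

/-- The vector `(a₁ + b₁ω, a₂ + b₂ω, a₃ + b₃ω)` of `𝒪₁₁³`, given by its integer coordinates. -/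
structure IntVec where
  a₁ : ℤ
  b₁ : ℤ
  a₂ : ℤ
  b₂ : ℤ
  a₃ : ℤ
  b₃ : ℤ

namespace IntVec

/-- The vector of `ℂ³` with the given integer coordinates. -/
noncomputable def toVec (p : IntVec) : Fin 3 → ℂ :=
  ![ofInts p.a₁ p.b₁, ofInts p.a₂ p.b₂, ofInts p.a₃ p.b₃]

/-- The integer coordinates of `⟨q, p⟩` in the basis `1, ω`. -/
def pairing (q p : IntVec) : ℤ × ℤ :=
  ((p.a₁ + p.b₁) * q.a₃ + 3 * p.b₁ * q.b₃ + (p.a₂ + p.b₂) * q.a₂ + 3 * p.b₂ * q.b₂ +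
    (p.a₃ + p.b₃) * q.a₁ + 3 * p.b₃ * q.b₁,
   p.a₁ * q.b₃ - p.b₁ * q.a₃ + (p.a₂ * q.b₂ - p.b₂ * q.a₂) + (p.a₃ * q.b₁ - p.b₃ * q.a₁))

theorem herm_toVec (q p : IntVec) :
    herm q.toVec p.toVec = ofInts (q.pairing p).1 (q.pairing p).2 := by
  have h := omega_sq
  simp [herm_apply, toVec, conj_ofInts, pairing]
  simp only [ofInts]
  push_cast
  linear_combination (-(p.b₁ * q.b₃ + p.b₂ * q.b₂ + p.b₃ * q.b₁) : ℂ) * h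

theorem toVec_mem (p : IntVec) (i : Fin 3) : p.toVec i ∈ ringO 11 := by
  fin_cases i <;> exact ofInts_mem _ _

/-- Decides whether `p` and `q` are isotropic with `⟨q, p⟩ = 1`. -/
def isCuspPair (p q : IntVec) : Bool :=
  p.pairing p = (0, 0) && q.pairing q = (0, 0) && q.pairing p = (1, 0)

theorem isCusp_of_isCuspPair {p q : IntVec} (h : isCuspPair p q = true) : IsCusp p.toVec := by
  simp only [isCuspPair, Bool.and_eq_true, decide_eq_true_eq] at h
  obtain ⟨⟨hp, hq⟩, hqp⟩ := h
  exact ⟨q.toVec, p.toVec_mem, q.toVec_mem, by simp [herm_toVec, hp, ofInts],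
    by simp [herm_toVec, hq, ofInts], by simp [herm_toVec, hqp, ofInts]⟩

/-- The norm `|p₃|²` of the last coordinate. -/
def depth (p : IntVec) : ℤ := p.a₃ ^ 2 + p.a₃ * p.b₃ + 3 * p.b₃ ^ 2

/-- For isotropic `p` this is `4 |p₃|² |⟨ψ(z, v, u), p⟩|²`, where `z = x + i√11 t` and `v = √11 w`.
The inequality `p.cygan x t w u < 4 |p₃|²` defines the Cygan ball at height `u` of the horoball at
`p`. -/
noncomputable def cygan (p : IntVec) (x t w u : ℝ) : ℝ :=
  ((((2 * p.a₃ + p.b₃) * x - 11 * p.b₃ * t - (2 * p.a₂ + p.b₂)) ^ 2 +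
    11 * ((2 * p.a₃ + p.b₃) * t + p.b₃ * x - p.b₂) ^ 2) / 4 + p.depth * u) ^ 2 +
  11 * (p.depth * w + (2 * p.a₂ * p.a₃ + 6 * p.b₂ * p.b₃ + p.a₂ * p.b₃ + p.a₃ * p.b₂) * t +
    (p.a₂ * p.b₃ - p.a₃ * p.b₂) * x + (p.a₁ * p.b₃ - p.b₁ * p.a₃)) ^ 2

theorem cygan_eq {p : IntVec} (hp : (p.pairing p).1 = 0) (x t w u : ℝ) :
    p.cygan x t w u = 4 * p.depth *
      Complex.normSq (herm (psi (x + Complex.I * Real.sqrt 11 * t) (Real.sqrt 11 * w) u)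
        p.toVec) := by
  set θ : ℂ := Complex.I * Real.sqrt 11 with hθ_def
  have hθ : θ ^ 2 = -11 := by simpa using I_mul_sqrt_sq 11
  have h11 : Real.sqrt 11 ^ 2 = 11 := Real.sq_sqrt (by norm_num)
  have hz := norm_add_I_mul_sqrt_sq x t
  rw [← hθ_def] at hz
  -- The two real coordinates of `⟨ψ, p⟩` in the basis `1, i√11`.
  set A : ℝ := (p.a₁ + p.b₁ / 2) + (p.a₂ + p.b₂ / 2) * x + 11 * (p.b₂ / 2) * t +
    (p.a₃ + p.b₃ / 2) * ((-(x ^ 2 + 11 * t ^ 2) - u) / 2) + 11 * (p.b₃ / 2) * (w / 2) with hA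
  set B : ℝ := -(p.b₁ / 2) + (p.a₂ + p.b₂ / 2) * t - p.b₂ / 2 * x +
    (p.a₃ + p.b₃ / 2) * (w / 2) - p.b₃ / 2 * ((-(x ^ 2 + 11 * t ^ 2) - u) / 2) with hB
  have hH : herm (psi (x + θ * t) (Real.sqrt 11 * w) u) p.toVec = A + θ * B := by
    simp [herm_apply, psi, toVec, conj_ofInts, hz]
    have hω : omega = (1 + θ) / 2 := rfl
    have hv : Complex.I * (Real.sqrt 11 * w) = θ * w := by rw [hθ_def]; ring
    simp only [ofInts, hv, hω, hA, hB]
    push_cast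
    linear_combination (-(p.b₂ / 2) * t - p.b₃ / 2 * (w / 2) : ℂ) * hθ
  have hn : Complex.normSq (A + θ * B) = A ^ 2 + 11 * B ^ 2 := by
    have : (A + θ * B : ℂ) = ⟨A, Real.sqrt 11 * B⟩ := by
      apply Complex.ext <;> simp [hθ_def]
    rw [this, Complex.normSq_mk]
    linear_combination B ^ 2 * h11
  have hiso : (2 * p.a₁ * p.a₃ + 6 * p.b₁ * p.b₃ + p.a₁ * p.b₃ + p.b₁ * p.a₃ +
      (p.a₂ ^ 2 + p.a₂ * p.b₂ + 3 * p.b₂ ^ 2) : ℝ) = 0 := by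
    have := congrArg (Int.cast : ℤ → ℝ) hp
    simp only [pairing] at this
    push_cast at this
    linear_combination this
  have hd : (p.depth : ℝ) = p.a₃ ^ 2 + p.a₃ * p.b₃ + 3 * p.b₃ ^ 2 := by
    simp [depth]
  -- Multiplication by `2 p₃` turns `⟨ψ, p⟩` into `-(|p₃ z - p₂|² + |p₃|² u)` plus an affine
  -- imaginary part; this uses that `p` is isotropic.
  have hre : 2 * ((p.a₃ + p.b₃ / 2) * A - 11 * (p.b₃ / 2) * B) =
      -((((2 * p.a₃ + p.b₃) * x - 11 * p.b₃ * t - (2 * p.a₂ + p.b₂)) ^ 2 +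
        11 * ((2 * p.a₃ + p.b₃) * t + p.b₃ * x - p.b₂) ^ 2) / 4 + p.depth * u) := by
    rw [hd, hA, hB]
    linear_combination hiso
  have him : 2 * ((p.a₃ + p.b₃ / 2) * B + p.b₃ / 2 * A) =
      p.depth * w + (2 * p.a₂ * p.a₃ + 6 * p.b₂ * p.b₃ + p.a₂ * p.b₃ + p.a₃ * p.b₂) * t +
        (p.a₂ * p.b₃ - p.a₃ * p.b₂) * x + (p.a₁ * p.b₃ - p.b₁ * p.a₃) := by
    rw [hd, hA, hB]
    ring
  rw [hH, hn, cygan, ← him, ← neg_sq, ← hre, hd]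
  ring

theorem depth_nonneg (p : IntVec) : 0 ≤ p.depth := by
  unfold depth
  nlinarith [sq_nonneg (2 * p.a₃ + p.b₃), sq_nonneg p.b₃]

/-- Convexity of `((r² + 11 s²) / 4 + c)² + 11 l²` in `(r, s, l)`. -/
theorem convexCombination_le {a b c : ℝ} (ha : 0 ≤ a) (hb : 0 ≤ b) (hab : a + b = 1) (hc : 0 ≤ c)
    (r r' s s' l l' : ℝ) :
    (((a * r + b * r') ^ 2 + 11 * (a * s + b * s') ^ 2) / 4 + c) ^ 2 + 11 * (a * l + b * l') ^ 2 ≤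
      a * (((r ^ 2 + 11 * s ^ 2) / 4 + c) ^ 2 + 11 * l ^ 2) +
        b * (((r' ^ 2 + 11 * s' ^ 2) / 4 + c) ^ 2 + 11 * l' ^ 2) := by
  obtain rfl : b = 1 - a := by linarith
  have hsq : ∀ y y' : ℝ, (a * y + (1 - a) * y') ^ 2 ≤ a * y ^ 2 + (1 - a) * y' ^ 2 := fun y y' ↦ by
    nlinarith [mul_nonneg (mul_nonneg ha hb) (sq_nonneg (y - y'))]
  have hmono : (((a * r + (1 - a) * r') ^ 2 + 11 * (a * s + (1 - a) * s') ^ 2) / 4 + c) ^ 2 ≤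
      (a * ((r ^ 2 + 11 * s ^ 2) / 4 + c) + (1 - a) * ((r' ^ 2 + 11 * s' ^ 2) / 4 + c)) ^ 2 :=
    pow_le_pow_left₀ (by positivity) (by linarith [hsq r r', hsq s s']) 2
  linarith [hmono.trans (hsq ((r ^ 2 + 11 * s ^ 2) / 4 + c) ((r' ^ 2 + 11 * s' ^ 2) / 4 + c)),
    hsq l l']

/-- The function `cygan` is the sum of the square of a non-negative convex function and the square
of an affine one. -/
theorem convexOn_cygan (p : IntVec) {u : ℝ} (hu : 0 ≤ u) :
    ConvexOn ℝ Set.univ fun y : ℝ × ℝ × ℝ ↦ p.cygan y.1 y.2.1 y.2.2 u := by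
  refine ⟨convex_univ, fun y _ y' _ a b ha hb hab ↦ ?_⟩
  have hc : (0 : ℝ) ≤ p.depth * u := mul_nonneg (by exact_mod_cast p.depth_nonneg) hu
  simp only [cygan, Prod.fst_add, Prod.snd_add, Prod.smul_fst, Prod.smul_snd, smul_eq_mul]
  refine (le_of_eq ?_).trans (convexCombination_le ha hb hab hc _ _ _ _ _ _)
  obtain rfl : b = 1 - a := by linarith
  ring

/-- Decides whether the point `(X, T, W) / 64` at height `39 / 128` lies in the Cygan ball of `p`;
this is `p.cygan (X / 64) (T / 64) (W / 64) (39 / 128) < 4 |p₃|²` with denominators cleared, and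
`4992 = 4 * 64 ^ 2 * (39 / 128)`. -/
def holdsAt (p : IntVec) (X T W : ℤ) : Bool :=
  (((2 * p.a₃ + p.b₃) * X - 11 * p.b₃ * T - 64 * (2 * p.a₂ + p.b₂)) ^ 2 +
    11 * ((2 * p.a₃ + p.b₃) * T + p.b₃ * X - 64 * p.b₂) ^ 2 + 4992 * p.depth) ^ 2 +
  11 * (256 * (p.depth * W +
    (2 * p.a₂ * p.a₃ + 6 * p.b₂ * p.b₃ + p.a₂ * p.b₃ + p.a₃ * p.b₂) * T +
    (p.a₂ * p.b₃ - p.a₃ * p.b₂) * X + 64 * (p.a₁ * p.b₃ - p.b₁ * p.a₃))) ^ 2 < 64 ^ 5 * p.depth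

theorem cygan_lt_of_holdsAt {p : IntVec} {X T W : ℤ} (h : p.holdsAt X T W = true) :
    p.cygan (X / 64) (T / 64) (W / 64) (39 / 128) < 4 * p.depth := by
  rw [holdsAt, decide_eq_true_eq] at h
  have h' := (Int.cast_lt (R := ℝ)).2 h
  push_cast at h'
  rw [← mul_lt_mul_iff_of_pos_left (a := (16 * 64 ^ 4 : ℝ)) (by norm_num)]
  refine lt_of_eq_of_lt ?_ (h'.trans_eq ?_)
  · rw [cygan]
    ring
  · ring

end IntVec

/-! ### A verified bisection of the fundamental box -/

/-- The box `[x, x'] × [t, t'] × [w, w']`, in units of `1/64`. -/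
structure Box where
  x : ℤ
  x' : ℤ
  t : ℤ
  t' : ℤ
  w : ℤ
  w' : ℤ

namespace Box

/-- The set of points of `ℝ³` in the box. -/
def toSet (B : Box) : Set (ℝ × ℝ × ℝ) :=
  Set.Icc (B.x / 64 : ℝ) (B.x' / 64) ×ˢ Set.Icc (B.t / 64 : ℝ) (B.t' / 64) ×ˢ
    Set.Icc (B.w / 64 : ℝ) (B.w' / 64)

/-- Decides whether the eight vertices of the box lie in the Cygan ball of `p`. -/
def inBall (B : Box) (p : IntVec) : Bool :=
  p.holdsAt B.x B.t B.w && p.holdsAt B.x B.t B.w' && p.holdsAt B.x B.t' B.w &&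
  p.holdsAt B.x B.t' B.w' && p.holdsAt B.x' B.t B.w && p.holdsAt B.x' B.t B.w' &&
  p.holdsAt B.x' B.t' B.w && p.holdsAt B.x' B.t' B.w'

/-- Cygan balls are convex in the coordinates `(x, t, w)`, so a ball that contains the vertices of
a box contains the box. -/
theorem cygan_lt_of_inBall {B : Box} {p : IntVec} (h : B.inBall p = true) {y : ℝ × ℝ × ℝ}
    (hy : y ∈ B.toSet) : p.cygan y.1 y.2.1 y.2.2 (39 / 128) < 4 * p.depth := by
  have hhull : B.toSet ⊆ convexHull ℝ (({(B.x / 64 : ℝ), (B.x' / 64 : ℝ)} : Set ℝ) ×ˢ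
      ({(B.t / 64 : ℝ), (B.t' / 64 : ℝ)} : Set ℝ) ×ˢ
      ({(B.w / 64 : ℝ), (B.w' / 64 : ℝ)} : Set ℝ)) := by
    rw [convexHull_prod, convexHull_prod, convexHull_pair, convexHull_pair, convexHull_pair]
    exact Set.prod_mono Icc_subset_segment
      (Set.prod_mono Icc_subset_segment Icc_subset_segment)
  have hconv := (p.convexOn_cygan (u := 39 / 128) (by norm_num)).convex_lt (4 * p.depth)
  simp only [inBall, Bool.and_eq_true] at h
  obtain ⟨⟨⟨⟨⟨⟨⟨h1, h2⟩, h3⟩, h4⟩, h5⟩, h6⟩, h7⟩, h8⟩ := h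
  refine (convexHull_min ?_ hconv (hhull hy)).2
  rintro ⟨x, t, w⟩ ⟨hx, ht, hw⟩
  refine ⟨trivial, ?_⟩
  rcases hx with rfl | rfl <;> rcases ht with rfl | rfl <;> rcases hw with rfl | rfl <;>
    exact IntVec.cygan_lt_of_holdsAt ‹_›

/-- Searches for a ball from the list `L` that contains the box, and if there is none halves the
box along its longest side, up to `k` times. The sides are compared with weights `1 : 3 : 2`. -/
def covered (L : List IntVec) : ℕ → Box → Bool
  | 0, B => L.any B.inBall
  | k + 1, B => L.any B.inBall ||
      if 3 * (B.t' - B.t) ≤ B.x' - B.x ∧ 2 * (B.w' - B.w) ≤ B.x' - B.x then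
        covered L k { B with x' := (B.x + B.x') / 2 } &&
        covered L k { B with x := (B.x + B.x') / 2 }
      else if 2 * (B.w' - B.w) ≤ 3 * (B.t' - B.t) then
        covered L k { B with t' := (B.t + B.t') / 2 } &&
        covered L k { B with t := (B.t + B.t') / 2 }
      else
        covered L k { B with w' := (B.w + B.w') / 2 } &&
        covered L k { B with w := (B.w + B.w') / 2 }

theorem exists_cygan_lt_of_covered {L : List IntVec} {k : ℕ} {B : Box}
    (h : covered L k B = true) {y : ℝ × ℝ × ℝ} (hy : y ∈ B.toSet) :
    ∃ p ∈ L, p.cygan y.1 y.2.1 y.2.2 (39 / 128) < 4 * p.depth := by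
  induction k generalizing B with
  | zero =>
    obtain ⟨p, hp, hB⟩ := List.any_eq_true.1 h
    exact ⟨p, hp, cygan_lt_of_inBall hB hy⟩
  | succ k ih =>
    rw [covered, Bool.or_eq_true] at h
    rcases h with h | h
    · obtain ⟨p, hp, hB⟩ := List.any_eq_true.1 h
      exact ⟨p, hp, cygan_lt_of_inBall hB hy⟩
    obtain ⟨hx, ht, hw⟩ := hy
    split_ifs at h
    · obtain ⟨h1, h2⟩ := Bool.and_eq_true_iff.1 h
      rcases le_total y.1 (((B.x + B.x') / 2 : ℤ) / 64) with hm | hm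
      · exact ih h1 ⟨⟨hx.1, hm⟩, ht, hw⟩
      · exact ih h2 ⟨⟨hm, hx.2⟩, ht, hw⟩
    · obtain ⟨h1, h2⟩ := Bool.and_eq_true_iff.1 h
      rcases le_total y.2.1 (((B.t + B.t') / 2 : ℤ) / 64) with hm | hm
      · exact ih h1 ⟨hx, ⟨ht.1, hm⟩, hw⟩
      · exact ih h2 ⟨hx, ⟨hm, ht.2⟩, hw⟩
    · obtain ⟨h1, h2⟩ := Bool.and_eq_true_iff.1 h
      rcases le_total y.2.2 (((B.w + B.w') / 2 : ℤ) / 64) with hm | hm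
      · exact ih h1 ⟨hx, ht, hw.1, hm⟩
      · exact ih h2 ⟨hx, ht, hm, hw.2⟩

end Box

/-- Fourteen isotropic vectors `p` of `𝒪₁₁³`, each with an isotropic `q` such that `⟨q, p⟩ = 1`.
Their Cygan balls at height `39 / 128` cover a fundamental box of the stabilizer of `∞`. -/
def cuspPairs : List (IntVec × IntVec) :=
  [(⟨0, -1, -1, 0, 1, 0⟩, ⟨1, 0, 0, 0, 0, 0⟩),
   (⟨0, 0, 0, 0, 1, 0⟩, ⟨1, 0, 0, 0, 0, 0⟩),
   (⟨0, -1, 1, 0, 1, 0⟩, ⟨1, 0, 0, 0, 0, 0⟩),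
   (⟨-1, 1, 1, 0, 1, 0⟩, ⟨1, 0, 0, 0, 0, 0⟩),
   (⟨-1, -1, -1, 1, 1, 0⟩, ⟨1, 0, 0, 0, 0, 0⟩),
   (⟨-1, -1, 0, 1, 1, 0⟩, ⟨1, 0, 0, 0, 0, 0⟩),
   (⟨-1, -1, -2, 0, -1, 1⟩, ⟨1, 0, 1, 0, 0, -1⟩),
   (⟨1, 0, -1, 0, -1, 1⟩, ⟨0, 0, 0, 0, 1, 0⟩),
   (⟨3, 1, -1, -1, -2, 1⟩, ⟨-1, -1, -1, 1, 1, 0⟩),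
   (⟨1, -2, 0, 0, 3, 0⟩, ⟨-2, 1, -1, 0, -1, -1⟩),
   (⟨-2, 3, 0, 1, 3, 0⟩, ⟨1, -2, 0, 0, -2, 0⟩),
   (⟨5, -3, -2, 2, 2, 2⟩, ⟨-3, 2, 2, -1, -1, -1⟩),
   (⟨1, -3, 1, 1, 5, 0⟩, ⟨-2, 3, 0, -2, -4, -1⟩),
   (⟨5, 0, -2, 1, -2, 3⟩, ⟨-3, 3, 0, -1, -4, -1⟩)]

theorem isCuspPair_of_mem : ∀ r ∈ cuspPairs, IntVec.isCuspPair r.1 r.2 = true ∧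
    0 < r.1.depth := by
  decide +kernel

theorem covered_cuspPairs :
    Box.covered (cuspPairs.map Prod.fst) 14 ⟨0, 32, 0, 16, -64, 64⟩ = true := by
  decide +kernel

/-! ### Reduction to the fundamental box -/

/-- Some cusp vector `p` satisfies `|⟨Z, p⟩|² ≤ 2999 / 3000`. For `Z` with `⟨Z, e₁⟩ = 1` this says
that the height of `[Z]` for `p` exceeds that for `e₁` by the factor `3000 / 2999` or more. -/
def HasCloserCusp (Z : Fin 3 → ℂ) : Prop :=
  ∃ p, IsCusp p ∧ Complex.normSq (herm Z p) ≤ 2999 / 3000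

/-- The Heisenberg translation with parameters `τ` and `σ`; it is unitary if
`σ + conj σ = -|τ|²`. -/
def heisenberg (τ σ : ℂ) (Z : Fin 3 → ℂ) : Fin 3 → ℂ :=
  ![Z 0 - conj τ * Z 1 + σ * Z 2, Z 1 + τ * Z 2, Z 2]

theorem herm_heisenberg {τ σ : ℂ} (h : σ + conj σ = -(τ * conj τ)) (Z W : Fin 3 → ℂ) :
    herm (heisenberg τ σ Z) (heisenberg τ σ W) = herm Z W := by
  simp [herm_apply, heisenberg]
  linear_combination (conj (W 2) * Z 2) * h

theorem herm_heisenberg_left (τ σ : ℂ) (Z W : Fin 3 → ℂ) :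
    herm (heisenberg τ σ Z) W = herm Z (heisenberg (-τ) (conj σ) W) := by
  simp [herm_apply, heisenberg]
  ring

theorem IsCusp.heisenberg {p : Fin 3 → ℂ} (hp : IsCusp p) {τ σ : ℂ} (hτ : τ ∈ ringO 11)
    (hσ : σ ∈ ringO 11) (h : σ + conj σ = -(τ * conj τ)) : IsCusp (heisenberg τ σ p) := by
  have hmem : ∀ r : Fin 3 → ℂ, (∀ i, r i ∈ ringO 11) →
      ∀ i, PicardModular.heisenberg τ σ r i ∈ ringO 11 := fun r hr i ↦ by
    fin_cases i
    · exact add_mem (sub_mem (hr 0) (mul_mem (conj_mem_ringO hτ) (hr 1))) (mul_mem hσ (hr 2))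
    · exact add_mem (hr 1) (mul_mem hτ (hr 2))
    · exact hr 2
  obtain ⟨q, hpO, hqO, hpp, hqq, hqp⟩ := hp
  exact ⟨_, hmem p hpO, hmem q hqO, by rw [herm_heisenberg h, hpp],
    by rw [herm_heisenberg h, hqq], by rw [herm_heisenberg h, hqp]⟩

theorem HasCloserCusp.of_heisenberg {Z : Fin 3 → ℂ} {τ σ : ℂ} (hτ : τ ∈ ringO 11)
    (hσ : σ ∈ ringO 11) (h : σ + conj σ = -(τ * conj τ))
    (hZ : HasCloserCusp (heisenberg τ σ Z)) : HasCloserCusp Z := by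
  obtain ⟨p, hp, hle⟩ := hZ
  refine ⟨heisenberg (-τ) (conj σ) p, hp.heisenberg (neg_mem hτ) (conj_mem_ringO hσ) ?_, ?_⟩
  · simp only [Complex.conj_conj, map_neg]
    linear_combination h
  · rwa [← herm_heisenberg_left]

/-- The reflection `diag(1, -1, 1)`. -/
def reflection (Z : Fin 3 → ℂ) : Fin 3 → ℂ := ![Z 0, -Z 1, Z 2]

theorem herm_reflection (Z W : Fin 3 → ℂ) : herm (reflection Z) (reflection W) = herm Z W := by
  simp [herm_apply, reflection]

theorem HasCloserCusp.of_reflection {Z : Fin 3 → ℂ} (hZ : HasCloserCusp (reflection Z)) :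
    HasCloserCusp Z := by
  have hmem : ∀ r : Fin 3 → ℂ, (∀ i, r i ∈ ringO 11) → ∀ i, reflection r i ∈ ringO 11 :=
    fun r hr i ↦ by
      fin_cases i
      · exact hr 0
      · exact neg_mem (hr 1)
      · exact hr 2
  have hinv : reflection (reflection Z) = Z := by
    ext i
    fin_cases i <;> simp [reflection]
  obtain ⟨p, ⟨q, hpO, hqO, hpp, hqq, hqp⟩, hle⟩ := hZ
  refine ⟨reflection p, ⟨reflection q, hmem p hpO, hmem q hqO, by rwa [herm_reflection],
    by rwa [herm_reflection], by rwa [herm_reflection]⟩, ?_⟩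
  rwa [← hinv, herm_reflection]

theorem herm_conj (Z W : Fin 3 → ℂ) :
    herm (fun i ↦ conj (Z i)) (fun i ↦ conj (W i)) = conj (herm Z W) := by
  simp [herm_apply]

theorem HasCloserCusp.of_conj {Z : Fin 3 → ℂ} (hZ : HasCloserCusp fun i ↦ conj (Z i)) :
    HasCloserCusp Z := by
  obtain ⟨p, ⟨q, hpO, hqO, hpp, hqq, hqp⟩, hle⟩ := hZ
  refine ⟨fun i ↦ conj (p i), ⟨fun i ↦ conj (q i), fun i ↦ conj_mem_ringO (hpO i),
    fun i ↦ conj_mem_ringO (hqO i), by rw [herm_conj, hpp, map_zero],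
    by rw [herm_conj, hqq, map_zero], by rw [herm_conj, hqp, map_one]⟩, ?_⟩
  have h := herm_conj (fun i ↦ conj (Z i)) p
  simp only [Complex.conj_conj] at h
  rwa [h, Complex.normSq_conj]

/-- The standard lift of the point with `z = x + i√11 t` and `v = √11 w`. -/
noncomputable def boxPoint (x t w u : ℝ) : Fin 3 → ℂ :=
  psi (x + Complex.I * Real.sqrt 11 * t) (Real.sqrt 11 * w) u

theorem boxPoint_eq (x t w u : ℝ) : boxPoint x t w u =
    ![(-(x ^ 2 + 11 * t ^ 2) - u + Complex.I * Real.sqrt 11 * w) / 2,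
      x + Complex.I * Real.sqrt 11 * t, 1] := by
  rw [boxPoint, psi, norm_add_I_mul_sqrt_sq, Complex.ofReal_mul, ← mul_assoc Complex.I]

theorem eq_boxPoint {Z : Fin 3 → ℂ} (hZ : Z 2 = 1) : ∃ x t w : ℝ,
    Z = boxPoint x t w (-(herm Z Z).re) := by
  have h11 : Real.sqrt 11 ^ 2 = 11 := Real.sq_sqrt (by norm_num)
  have h0 : Real.sqrt 11 ≠ 0 := by positivity
  refine ⟨(Z 1).re, (Z 1).im / Real.sqrt 11, 2 * (Z 0).im / Real.sqrt 11, ?_⟩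
  have hsq : 11 * ((Z 1).im / Real.sqrt 11) ^ 2 = (Z 1).im ^ 2 := by
    rw [div_pow, h11]
    ring
  have hre : (herm Z Z).re = 2 * (Z 0).re + (Z 1).re ^ 2 + (Z 1).im ^ 2 := by
    simp [herm_apply, hZ]
    ring
  have hsq' : (11 : ℂ) * (((Z 1).im / Real.sqrt 11 : ℝ) : ℂ) ^ 2 = ((Z 1).im : ℂ) ^ 2 := by
    exact_mod_cast hsq
  rw [boxPoint_eq, hsq']
  ext i
  fin_cases i
  · apply Complex.ext
    · simp [hre, ← Complex.ofReal_pow]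
    · simp [← Complex.ofReal_pow]
      field_simp
  · apply Complex.ext <;> (simp; try field_simp)
  · simpa using hZ

/-- The gap between the heights `39 / 128` and `0.3015114` turns the strict inequality that defines
a Cygan ball into a bound uniform in the point. -/
theorem le_of_cygan_lt {a l n u N : ℝ} (ha : 0 ≤ a) (hn : 1 ≤ n) (hu : 0 ≤ u)
    (hu' : u ≤ 0.3015114) (hlt : (a + n * (39 / 128)) ^ 2 + l < 4 * n)
    (hN : 4 * n * N = (a + n * u) ^ 2 + l) : N ≤ 2999 / 3000 := by
  have h1 : n ^ 2 * ((39 / 128) ^ 2 - u ^ 2) ≤ (a + n * (39 / 128)) ^ 2 - (a + n * u) ^ 2 := by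
    have : 0 ≤ a * n * (39 / 128 - u) :=
      mul_nonneg (mul_nonneg ha (by linarith)) (by linarith)
    linarith
  have h2 : (4 / 3000 : ℝ) ≤ (39 / 128) ^ 2 - u ^ 2 := by
    have := pow_le_pow_left₀ hu hu' 2
    norm_num at this ⊢
    linarith
  have h3 : n * (4 / 3000) ≤ n ^ 2 * ((39 / 128) ^ 2 - u ^ 2) := by
    have := mul_le_mul (le_self_pow₀ hn two_ne_zero) h2 (by norm_num) (by positivity)
    exact this
  have h4 : 4 * n * N < 4 * n * (2999 / 3000) := by linarith
  exact (lt_of_mul_lt_mul_left h4 (by linarith)).le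

/-- A point of the fundamental box lies in one of the fourteen Cygan balls at height `39 / 128`;
`le_of_cygan_lt` carries this down to the heights up to `0.3015114`. -/
theorem hasCloserCusp_of_mem_box {x t w u : ℝ} (hx : x ∈ Set.Icc 0 (1 / 2))
    (ht : t ∈ Set.Icc 0 (1 / 4)) (hw : w ∈ Set.Icc (-1) 1) (hu : 0 ≤ u) (hu' : u ≤ 0.3015114) :
    HasCloserCusp (boxPoint x t w u) := by
  obtain ⟨p, hp, hlt⟩ := Box.exists_cygan_lt_of_covered covered_cuspPairs (y := (x, t, w)) (by
    refine ⟨?_, ?_, ?_⟩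
    · norm_num; exact hx
    · norm_num; exact ht
    · norm_num; exact hw)
  obtain ⟨r, hr, rfl⟩ := List.mem_map.1 hp
  obtain ⟨hpair, hpos⟩ := isCuspPair_of_mem r hr
  refine ⟨r.1.toVec, IntVec.isCusp_of_isCuspPair hpair, ?_⟩
  have hiso : (r.1.pairing r.1).1 = 0 := by
    simp only [IntVec.isCuspPair, Bool.and_eq_true, decide_eq_true_eq] at hpair
    rw [hpair.1.1]
  have hn : (1 : ℝ) ≤ r.1.depth := by exact_mod_cast hpos
  have hmul := IntVec.cygan_eq hiso x t w u
  simp only [IntVec.cygan] at hlt hmul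
  rw [boxPoint]
  exact le_of_cygan_lt (by positivity) hn hu hu' hlt hmul.symm

theorem HasCloserCusp.boxPoint_neg {x t w u : ℝ} (h : HasCloserCusp (boxPoint (-x) (-t) w u)) :
    HasCloserCusp (boxPoint x t w u) := by
  refine of_reflection ?_
  convert h using 1
  ext i
  fin_cases i <;> simp [boxPoint_eq, reflection]
  ring

theorem HasCloserCusp.boxPoint_conj {x t w u : ℝ} (h : HasCloserCusp (boxPoint x (-t) (-w) u)) :
    HasCloserCusp (boxPoint x t w u) := by
  refine of_conj ?_
  convert h using 1
  ext i
  fin_cases i <;> simp [boxPoint_eq, Complex.conj_ofNat]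

theorem HasCloserCusp.boxPoint_add {x t w u : ℝ} (k : ℤ)
    (h : HasCloserCusp (boxPoint x t (w + 2 * k) u)) : HasCloserCusp (boxPoint x t w u) := by
  refine of_heisenberg (τ := 0) (σ := ofInts (-k) (2 * k)) (zero_mem _) (ofInts_mem _ _) ?_ ?_
  · rw [conj_ofInts]
    simp only [ofInts]
    push_cast
    ring
  · convert h using 1
    ext i
    fin_cases i <;> simp [boxPoint_eq, heisenberg, ofInts, omega]
    ring

/-- Translations by `𝒪₁₁` move `z` into a fundamental rectangle of the lattice, conjugation and
the reflection move it into a quarter of that rectangle, and the centre of the Heisenberg group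
takes care of `v`. -/
theorem hasCloserCusp_of_apply_two {Z : Fin 3 → ℂ} (hZ : Z 2 = 1) (hneg : (herm Z Z).re ≤ 0)
    (hle : -(herm Z Z).re ≤ 0.3015114) : HasCloserCusp Z := by
  obtain ⟨u, hu⟩ : ∃ u, u = -(herm Z Z).re := ⟨_, rfl⟩
  have hu0 : 0 ≤ u := by linarith
  rw [← hu] at hle
  -- The vertical coordinate.
  have hvert : ∀ x t w : ℝ, x ∈ Set.Icc 0 (1 / 2) → t ∈ Set.Icc 0 (1 / 4) →
      HasCloserCusp (boxPoint x t w u) := fun x t w hx ht ↦ by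
    refine .boxPoint_add (-round (w / 2)) (hasCloserCusp_of_mem_box hx ht ?_ hu0 hle)
    have h := abs_le.1 (abs_sub_round (w / 2))
    push_cast
    constructor <;> linarith [h.1, h.2]
  -- The signs of `x` and `t`.
  have hsign : ∀ x t w : ℝ, |x| ≤ 1 / 2 → |t| ≤ 1 / 4 → HasCloserCusp (boxPoint x t w u) :=
    fun x t w hx ht ↦ by
    rw [abs_le] at hx ht
    rcases le_total 0 x with h | h <;> rcases le_total 0 t with h' | h'
    · exact hvert x t w ⟨h, hx.2⟩ ⟨h', ht.2⟩
    · exact .boxPoint_conj (hvert _ _ _ ⟨h, hx.2⟩ ⟨by linarith, by linarith⟩)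
    · refine .boxPoint_neg (.boxPoint_conj (hvert _ _ _ ⟨by linarith, by linarith⟩ ?_))
      rw [neg_neg]
      exact ⟨h', ht.2⟩
    · exact .boxPoint_neg (hvert _ _ _ ⟨by linarith, by linarith⟩ ⟨by linarith, by linarith⟩)
  obtain ⟨x, t, w, hxt⟩ := eq_boxPoint hZ
  rw [← hu] at hxt
  set m : ℤ := -round (2 * t) with hm
  set k : ℤ := -round (x + m / 2) with hk
  have hσ : ofInts 0 (-(k ^ 2 + k * m + 3 * m ^ 2)) + conj (ofInts 0 (-(k ^ 2 + k * m + 3 * m ^ 2)))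
      = -(ofInts k m * conj (ofInts k m)) := by
    simp only [conj_ofInts]
    simp only [ofInts]
    push_cast
    linear_combination (-(m : ℂ) ^ 2) * omega_sq
  refine .of_heisenberg (ofInts_mem k m) (ofInts_mem _ _) hσ ?_
  have hZ' : heisenberg (ofInts k m) (ofInts 0 (-(k ^ 2 + k * m + 3 * m ^ 2))) Z 2 = 1 := hZ
  obtain ⟨x', t', w', h'⟩ := eq_boxPoint hZ'
  rw [herm_heisenberg hσ, ← hu] at h'
  have h1 := congrFun h' 1
  rw [hxt] at h1
  simp [boxPoint_eq, heisenberg, ofInts, omega] at h1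
  have hx' : x' = x + m / 2 + k := by
    have := congrArg Complex.re h1
    simp at this
    linarith
  have ht' : t' = t + m / 2 := by
    have := congrArg Complex.im h1
    simp at this
    have h0 : Real.sqrt 11 ≠ 0 := by positivity
    apply mul_left_cancel₀ h0
    linarith
  rw [h']
  refine hsign _ _ _ ?_ ?_
  · have h := abs_sub_round (x + m / 2)
    rwa [hx', show (k : ℝ) = -round (x + m / 2) from Int.cast_neg _, ← sub_eq_add_neg]
  · have h := abs_le.1 (abs_sub_round (2 * t))
    rw [ht', hm, Int.cast_neg, abs_le]
    constructor <;> linarith [h.1, h.2]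

/-! ### Covering by translates of the horoball -/

theorem mulVec_inv_mulVec (g : GL (Fin 3) ℂ) (Z : Fin 3 → ℂ) :
    g.val.mulVec ((g⁻¹).val.mulVec Z) = Z := by
  rw [Matrix.mulVec_mulVec, g.mul_inv, Matrix.one_mulVec]

theorem herm_mulVec {g : GL (Fin 3) ℂ} (hg : g ∈ U21Int 11) (Z W : Fin 3 → ℂ) :
    herm (g.val.mulVec Z) (g.val.mulVec W) = herm Z W :=
  hg.1 Z W

theorem inv_mulVec_apply_two {g : GL (Fin 3) ℂ} (hg : g ∈ U21Int 11) (Z : Fin 3 → ℂ) :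
    (g⁻¹).val.mulVec Z 2 = herm Z (g.val.mulVec infVec) := by
  have h := herm_mulVec hg ((g⁻¹).val.mulVec Z) infVec
  rwa [mulVec_inv_mulVec, herm_infVec, eq_comm] at h

theorem re_herm_smul (c : ℂ) (Z : Fin 3 → ℂ) :
    (herm (c • Z) (c • Z)).re = Complex.normSq c * (herm Z Z).re := by
  rw [herm_smul_smul, Complex.re_ofReal_mul]

/-- Write `p = g e₁`. The vector `g⁻¹ Z` has last coordinate `⟨Z, p⟩`; the vector `Y` is `g⁻¹ Z`
scaled so that its last coordinate is `1`. -/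
theorem exists_normalized {Z p : Fin 3 → ℂ} (hp : IsCusp p) (h0 : herm Z p ≠ 0) :
    ∃ g ∈ U21Int 11, ∃ Y : Fin 3 → ℂ, Y 2 = 1 ∧ Z = g.val.mulVec (herm Z p • Y) ∧
      (herm Z Z).re = Complex.normSq (herm Z p) * (herm Y Y).re := by
  obtain ⟨g, hg, rfl⟩ := hp.exists_mulVec_infVec
  set c := herm Z (g.val.mulVec infVec) with hc
  have hY : Z = g.val.mulVec (c • c⁻¹ • (g⁻¹).val.mulVec Z) := by
    rw [smul_inv_smul₀ h0, mulVec_inv_mulVec]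
  refine ⟨g, hg, c⁻¹ • (g⁻¹).val.mulVec Z, ?_, hY, ?_⟩
  · rw [Pi.smul_apply, inv_mulVec_apply_two hg, smul_eq_mul, ← hc, inv_mul_cancel₀ h0]
  · rw [← re_herm_smul, ← herm_mulVec hg _ (c • _), ← hY]

/-- If the height of `[Z]` seen from the cusp `p` is at most `0.3015114`, then the height seen
from some other cusp is larger by the factor `3000 / 2999` or more. -/
theorem exists_cusp_gain {Z p : Fin 3 → ℂ} (hZ : (herm Z Z).re < 0) (hp : IsCusp p)
    (h0 : herm Z p ≠ 0) (hle : -(herm Z Z).re ≤ 0.3015114 * Complex.normSq (herm Z p)) :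
    ∃ p', IsCusp p' ∧ Complex.normSq (herm Z p') ≤ 2999 / 3000 * Complex.normSq (herm Z p) := by
  obtain ⟨g, hg, Y, hY, hgY, hnorm⟩ := exists_normalized hp h0
  have hpos := Complex.normSq_pos.2 h0
  rw [hnorm] at hZ hle
  obtain ⟨q, hq, hqY⟩ := hasCloserCusp_of_apply_two hY (by nlinarith) (by nlinarith)
  refine ⟨g.val.mulVec q, hq.smul hg, ?_⟩
  have : herm Z (g.val.mulVec q) = herm Z p * herm Y q := by
    rw [← herm_smul_left, ← herm_mulVec hg _ q, ← hgY]
  rw [this, Complex.normSq_mul, mul_comm]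
  exact mul_le_mul_of_nonneg_right hqY hpos.le

/-- A cusp vector is not orthogonal to a negative vector: the orthogonal complement of `e₁` is the
plane `Z₃ = 0`, where the form is non-negative. -/
theorem herm_ne_zero {Z p : Fin 3 → ℂ} (hZ : (herm Z Z).re < 0) (hp : IsCusp p) :
    herm Z p ≠ 0 := by
  intro h
  obtain ⟨g, hg, rfl⟩ := hp.exists_mulVec_infVec
  have hlast : (g⁻¹).val.mulVec Z 2 = 0 := by rw [inv_mulVec_apply_two hg, h]
  have hnorm := herm_mulVec hg ((g⁻¹).val.mulVec Z) ((g⁻¹).val.mulVec Z)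
  rw [mulVec_inv_mulVec] at hnorm
  rw [hnorm, herm_apply, hlast, ← Complex.normSq_eq_conj_mul_self] at hZ
  simp only [mul_zero, map_zero, zero_mul, zero_add, add_zero, Complex.ofReal_re] at hZ
  exact absurd (Complex.normSq_nonneg _) (not_le.2 hZ)

/-- Every negative vector is at height greater than `0.3015114` for some cusp: otherwise the
descent could be repeated for ever, with `|⟨Z, p⟩|` tending to `0`. -/
theorem exists_cusp_height {Z : Fin 3 → ℂ} (hZ : (herm Z Z).re < 0) :
    ∃ p, IsCusp p ∧ 0.3015114 * Complex.normSq (herm Z p) < -(herm Z Z).re := by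
  by_contra! hcon
  have hdescent : ∀ k : ℕ, ∃ p, IsCusp p ∧
      Complex.normSq (herm Z p) ≤ (2999 / 3000) ^ k * Complex.normSq (herm Z infVec) := by
    intro k
    induction k with
    | zero => exact ⟨infVec, isCusp_infVec, by simp⟩
    | succ k ih =>
      obtain ⟨p, hp, hle⟩ := ih
      obtain ⟨p', hp', hle'⟩ := exists_cusp_gain hZ hp (herm_ne_zero hZ hp) (hcon p hp)
      exact ⟨p', hp', by rw [pow_succ']; linarith⟩
  have hlim : Filter.Tendsto (fun k : ℕ ↦ 0.3015114 *
      ((2999 / 3000 : ℝ) ^ k * Complex.normSq (herm Z infVec))) Filter.atTop (nhds 0) := by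
    simpa using ((tendsto_pow_atTop_nhds_zero_of_lt_one (r := (2999 / 3000 : ℝ)) (by norm_num)
      (by norm_num)).mul_const (Complex.normSq (herm Z infVec))).const_mul 0.3015114
  obtain ⟨k, hk⟩ := (hlim.eventually_lt_const (show (0 : ℝ) < -(herm Z Z).re by linarith)).exists
  obtain ⟨p, hp, hle⟩ := hdescent k
  have := hcon p hp
  linarith

theorem translatesCover : TranslatesCover 11 0.3015114 := by
  rintro _ ⟨Z, hZ0, hZ, rfl⟩
  obtain ⟨p, hp, hheight⟩ := exists_cusp_height hZ
  have h0 := herm_ne_zero hZ hp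
  obtain ⟨g, hg, Y, hY, hgY, hnorm⟩ := exists_normalized hp h0
  have hpos := Complex.normSq_pos.2 h0
  obtain ⟨x, t, w, hYbox⟩ := eq_boxPoint hY
  refine Set.mem_iUnion₂.2 ⟨Matrix.ProjGenLinGroup.mk g, ⟨g, hg, rfl⟩, ?_⟩
  refine ⟨Projectivization.mk ℂ (boxPoint x t w (-(herm Y Y).re)) (psi_ne_zero _ _ _),
    ⟨_, _, _, ?_, rfl⟩, ?_⟩
  · rw [hnorm] at hheight
    exact lt_of_mul_lt_mul_left (by linarith) hpos.le
  · change Projectivization.mk ℂ (g.val.mulVec (boxPoint x t w (-(herm Y Y).re))) _ = _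
    refine (Projectivization.mk_eq_mk_iff' ..).2 ⟨(herm Z p)⁻¹, ?_⟩
    rw [← hYbox, inv_smul_eq_iff₀ h0, ← Matrix.mulVec_smul, ← hgY]

/-! ### The covering depth -/

theorem herm_psi_self (z : ℂ) (v u : ℝ) : herm (psi z v u) (psi z v u) = -u := by
  simp [herm_apply, psi, Complex.conj_mul', Complex.conj_ofNat]
  ring

/-- The point `[ψ(0, 0, 2)]` has height at most `2` with respect to every cusp: for an isotropic
`p`, the value `|⟨ψ(0, 0, 2), p⟩|² = |p₁ - p₃|²` equals `|p₁|² + |p₂|² + |p₃|²`. -/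
theorem le_two_of_translatesCover {u : ℝ} (hu : TranslatesCover 11 u) : u ≤ 2 := by
  have hself : herm (psi 0 0 2) (psi 0 0 2) = -2 := by
    simp [herm_psi_self]
  have hmem := hu ⟨psi 0 0 2, psi_ne_zero 0 0 2, by rw [hself]; norm_num, rfl⟩
  obtain ⟨_, ⟨g, hg, rfl⟩, h⟩ := Set.mem_iUnion₂.1 hmem
  obtain ⟨_, ⟨z, v, u', hu', rfl⟩, h⟩ := h
  replace h : Projectivization.mk ℂ (g.val.mulVec (psi z v u')) _ =
    Projectivization.mk ℂ (psi 0 0 2) _ := h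
  obtain ⟨a, ha⟩ := (Projectivization.mk_eq_mk_iff' ..).1 h
  have hnorm : u' = 2 * Complex.normSq a := by
    have := re_herm_smul a (psi 0 0 2)
    rw [ha, herm_mulVec hg, herm_psi_self, hself] at this
    norm_num at this
    linarith
  obtain ⟨q, hpO, -, hpp, -, hqp⟩ := isCusp_infVec.smul hg
  have hone : Complex.normSq a * Complex.normSq (herm (psi 0 0 2) (g.val.mulVec infVec)) = 1 := by
    rw [← Complex.normSq_mul, ← herm_smul_left, ha, herm_mulVec hg, herm_infVec]
    simp [psi]
  generalize g.val.mulVec infVec = p at *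
  have hge : 1 ≤ Complex.normSq (herm (psi 0 0 2) p) := by
    have hsum : Complex.normSq (herm (psi 0 0 2) p) =
        Complex.normSq (p 0) + Complex.normSq (p 1) + Complex.normSq (p 2) := by
      have hre := congrArg Complex.re hpp
      simp [herm_apply] at hre
      simp [herm_apply, psi, Complex.normSq_apply]
      linarith
    obtain ⟨i, hi⟩ : ∃ i, p i ≠ 0 := by
      by_contra! hp
      simp [herm_apply, hp] at hqp
    have hi1 := one_le_normSq_of_mem_ringO (hpO i) hi
    rw [hsum]
    have := Complex.normSq_nonneg (p 0)
    have := Complex.normSq_nonneg (p 1)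
    have := Complex.normSq_nonneg (p 2)
    fin_cases i <;> simp at hi1 <;> linarith
  nlinarith [Complex.normSq_nonneg a]

theorem two_div_sqrt_lt : 2 / Real.sqrt 44 < (0.3015114 : ℝ) := by
  rw [div_lt_iff₀ (by positivity), ← div_lt_iff₀' (by norm_num)]
  exact Real.lt_sqrt_of_sq_lt (by norm_num)

theorem exists_isCoveringHeight : ∃ h, IsCoveringHeight 11 h ∧ 0.3015114 ≤ h ∧ h ≤ 2 := by
  have hmem : (0.3015114 : ℝ) ∈ {u : ℝ | 0 < u ∧ TranslatesCover 11 u} :=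
    ⟨by norm_num, translatesCover⟩
  have hub : 2 ∈ upperBounds {u : ℝ | 0 < u ∧ TranslatesCover 11 u} :=
    fun u hu ↦ le_two_of_translatesCover hu.2
  have hlub := isLUB_csSup ⟨_, hmem⟩ ⟨_, hub⟩
  exact ⟨_, hlub, hlub.1 hmem, hlub.2 hub⟩

/-- The inequalities that define the covering depth say that `n` is the integer part of
`4 / h²`. -/
theorem coveringDepth_iff {h : ℝ} (hh : 0 < h) {n : ℕ} (hn : 0 < n) :
    2 / Real.sqrt ((n : ℝ) + 1) < h ∧ h ≤ 2 / Real.sqrt n ↔ ⌊4 / h ^ 2⌋₊ = n := by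
  have hn' : (0 : ℝ) < n := by exact_mod_cast hn
  rw [Nat.floor_eq_iff (by positivity), and_comm, div_lt_iff₀ (by positivity),
    le_div_iff₀ (by positivity), ← div_lt_iff₀' hh, ← le_div_iff₀' hh,
    Real.sqrt_le_left (by positivity), Real.lt_sqrt (by positivity), div_pow]
  norm_num

end PicardModular

theorem corollary5 :
    2 / Real.sqrt 44 < (0.3015114 : ℝ) ∧
    PicardModular.TranslatesCover 11 0.3015114 ∧
    (∃! n : ℕ, PicardModular.IsCoveringDepth 11 n) ∧
    ∀ n : ℕ, PicardModular.IsCoveringDepth 11 n → n ≤ 43 := by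
  obtain ⟨h, hh, hlow, hup⟩ := PicardModular.exists_isCoveringHeight
  have hpos : 0 < h := lt_of_lt_of_le (by norm_num) hlow
  have hsq : 0 < h ^ 2 := by positivity
  have heq : ∀ n : ℕ, PicardModular.IsCoveringDepth 11 n → ⌊4 / h ^ 2⌋₊ = n := by
    rintro n ⟨hn, h', hh', hd⟩
    obtain rfl := hh.unique hh'
    exact (PicardModular.coveringDepth_iff hpos hn).1 hd
  refine ⟨PicardModular.two_div_sqrt_lt, PicardModular.translatesCover,
    ⟨⌊4 / h ^ 2⌋₊, ?_, fun n hn ↦ (heq n hn).symm⟩, fun n hn ↦ ?_⟩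
  · have hfloor : 0 < ⌊4 / h ^ 2⌋₊ := by
      rw [Nat.floor_pos, le_div_iff₀ hsq]
      nlinarith
    exact ⟨hfloor, h, hh, (PicardModular.coveringDepth_iff hpos hfloor).2 rfl⟩
  · rw [← heq n hn]
    refine Nat.lt_succ_iff.1 ((Nat.floor_lt (by positivity)).2 ?_)
    rw [div_lt_iff₀ hsq]
    have := pow_le_pow_left₀ (by norm_num) hlow 2
    norm_num at this ⊢
    linarith
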